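/- Let $\alpha>0$ and let $\xi_{(\alpha)}$ be a real random variable whose law is characterized by its Laplace transform $$\mathbb E\big[\exp(\lambda\,\xi_{(\alpha)})\big]=\exp\big(\phi_{(\alpha)}(\lambda)\big)<\infty,\qquad \lambda\in\mathbb R,\qquad\text{where}\quad \phi_{(\alpha)}(\lambda)=\frac{\alpha+1}{\alpha}\int_0^1\big(e^{\lambda u}-1\big)\,\frac{1-u}{u}\,\mathrm du .$$ For each $n\ge 1$ let $\xi_{(\alpha,1)},\dots,\xi_{(\alpha,n)}$ be i.i.d. copies of $\xi_{(\alpha)}$ (the family may depend on $n$; in particular, they may be the first $n$ terms of one i.i.d. sequence). Then $$\frac{\max\{\xi_{(\alpha,1)},\dots,\xi_{(\alpha,n)}\}\cdot\ln(\ln n)}{\ln n}\ \longrightarrow\ 1\qquad\text{in probability as } n\to\infty .$$ -/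

import Mathlib

open MeasureTheory ProbabilityTheory Filter

/-- The Laplace exponent
`φ_α(l) = (α + 1) / α * ∫_0^1 (exp (l u) - 1) (1 - u) / u du`. -/
noncomputable def xiExponent (α l : ℝ) : ℝ :=
  (α + 1) / α * ∫ u in (0 : ℝ)..1, (Real.exp (l * u) - 1) * ((1 - u) / u)

/-- `ν` is the law of `ξ_(α)`: the probability measure on the real line whose (two-sided) Laplace
transform is finite everywhere and equals `exp (φ_α(l))` at every real `l`. -/
structure IsXiLaw (α : ℝ) (ν : Measure ℝ) : Prop where
  isProbabilityMeasure : IsProbabilityMeasure ν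
  integrable_exp : ∀ l : ℝ, Integrable (fun x : ℝ => Real.exp (l * x)) ν
  mgf_eq : ∀ l : ℝ, mgf id ν l = Real.exp (xiExponent α l)

/-!
Differentiating under the integral, `φ'` is `(α + 1) / α` times the Laplace transform of
`(1 - u) du` on `[0, 1]`; it outgrows `exp (θ t)` for every `θ < 1`, is `O(exp t)`, and dominates
`φ''`. Tilting the law by `exp (t x)` gives mean `φ' t` and variance `φ'' t = o((φ' t) ^ 2)`, so
`ξ` concentrates near `φ' t` under the tilted law; undoing the tilt bounds `P(ξ ≥ y)` from below.
Chernoff's bound at `t = log y` is a matching upper bound, whence `log P(ξ ≥ y) ~ -y log y`.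

At the level `y = c log n / log (log n)` this is `-c log n` to first order, so `n P(ξ ≥ y)` tends
to `0` for `c > 1` and to `∞` for `c < 1`. A union bound handles the first case and independence,
via `P(max < y) ≤ exp (-n P(ξ ≥ y))`, the second.
-/

open Asymptotics
open scoped Topology

section Filters

lemma atTop_le_map_of_tendsto_of_continuousAt {α δ : Type*}
    [ConditionallyCompleteLinearOrder α] [Nonempty α] [TopologicalSpace α] [OrderTopology α]
    [DenselyOrdered α] [LinearOrder δ] [TopologicalSpace δ] [OrderClosedTopology δ]
    {f : α → δ} (hf : Tendsto f atTop atTop) (hc : ∀ᶠ t in atTop, ContinuousAt f t) :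
    atTop ≤ map f atTop := by
  intro s hs
  have hs : ∀ᶠ t in atTop, f t ∈ s := hs
  obtain ⟨a, ha⟩ := eventually_atTop.1 (hs.and hc)
  filter_upwards [eventually_ge_atTop (f a)] with y hy
  obtain ⟨b, hyb, hab⟩ := ((hf.eventually_ge_atTop y).and (eventually_ge_atTop a)).exists
  obtain ⟨t, ht, rfl⟩ := intermediate_value_Icc hab
    (fun t ht => (ha t ht.1).2.continuousWithinAt) ⟨hy, hyb⟩
  exact (ha t ht.1).1

lemma isEquivalent_log_neg_of_eventually_exp_le {ι : Type*} {l : Filter ι} {p h : ι → ℝ}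
    (hh : ∀ᶠ y in l, 0 ≤ h y)
    (hlower : ∀ ε > 0, ∀ᶠ y in l, Real.exp (-((1 + ε) * h y)) ≤ p y)
    (hupper : ∀ ε > 0, ∀ᶠ y in l, p y ≤ Real.exp (-((1 - ε) * h y))) :
    (fun y => Real.log (p y)) ~[l] fun y => -h y := by
  refine isLittleO_iff.2 fun ε hε => ?_
  filter_upwards [hh, hlower ε hε, hupper ε hε] with y hy hl hu
  have hp : 0 < p y := (Real.exp_pos _).trans_le hl
  have hl' := (Real.le_log_iff_exp_le hp).2 hl
  have hu' := (Real.log_le_iff_le_exp hp).2 hu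
  rw [norm_neg, Real.norm_of_nonneg hy, Pi.sub_apply, Real.norm_eq_abs, abs_le]
  constructor <;> linarith

end Filters

section Tilting

variable {Ω : Type*} [MeasurableSpace Ω] {μ : Measure Ω} {X : Ω → ℝ}

lemma measureReal_tilted_le_of_forall_le [IsFiniteMeasure μ] {f : Ω → ℝ} {s : Set Ω} {c : ℝ}
    (h : ∀ ω ∈ s, f ω ≤ c) :
    (μ.tilted f).real s ≤ Real.exp c / (∫ ω, Real.exp (f ω) ∂μ) * μ.real s := by
  have hint : 0 ≤ ∫ ω, Real.exp (f ω) ∂μ := integral_nonneg fun ω => (Real.exp_pos _).le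
  have hle : μ.tilted f s ≤
      ENNReal.ofReal (Real.exp c / ∫ ω, Real.exp (f ω) ∂μ) * μ s := by
    rw [tilted_apply, ← setLIntegral_const]
    exact setLIntegral_mono measurable_const fun ω hω => ENNReal.ofReal_le_ofReal
      (div_le_div_of_nonneg_right (Real.exp_le_exp.2 (h ω hω)) hint)
  have := ENNReal.toReal_mono (by finiteness) hle
  rwa [ENNReal.toReal_mul, ENNReal.toReal_ofReal (by positivity)] at this

/-- Under the law tilted by `t`, the mean and the variance of `X` are the first two derivatives of
the cumulant generating function at `t`, so this is Chebyshev's inequality. -/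
lemma one_sub_le_measureReal_tilted_abs_sub_deriv_cgf_lt [NeZero μ] {t r : ℝ}
    (hX : t ∈ interior (integrableExpSet X μ)) (hr : 0 < r) :
    1 - iteratedDeriv 2 (cgf X μ) t / r ^ 2 ≤
      (μ.tilted (fun ω => t * X ω)).real {ω | |X ω - deriv (cgf X μ) t| < r} := by
  set Q := μ.tilted (fun ω => t * X ω)
  set A := {ω | |X ω - deriv (cgf X μ) t| < r}
  have : IsProbabilityMeasure Q :=
    isProbabilityMeasure_tilted (interior_subset (s := integrableExpSet X μ) hX)
  have hchebyshev : Q.real Aᶜ ≤ iteratedDeriv 2 (cgf X μ) t / r ^ 2 := by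
    have hA : Aᶜ = {ω | r ≤ |X ω - deriv (cgf X μ) t|} := by ext; simp [A]
    rw [hA, ← integral_tilted_mul_self hX, ← variance_tilted_mul hX]
    exact ENNReal.toReal_le_of_le_ofReal (div_nonneg (variance_nonneg _ _) (sq_nonneg r))
      (meas_ge_le_variance_div_sq (memLp_tilted_mul hX 2) hr)
  have hcover : 1 ≤ Q.real A + Q.real Aᶜ := by
    rw [← probReal_univ (μ := Q), ← Set.union_compl_self A]
    exact measureReal_union_le _ _
  linarith

lemma le_measureReal_deriv_cgf_sub_le [IsFiniteMeasure μ] [NeZero μ] {t r : ℝ} (ht : 0 ≤ t)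
    (hX : t ∈ interior (integrableExpSet X μ)) (hr : 0 < r) :
    Real.exp (cgf X μ t - t * (deriv (cgf X μ) t + r)) *
        (1 - iteratedDeriv 2 (cgf X μ) t / r ^ 2) ≤
      μ.real {ω | deriv (cgf X μ) t - r ≤ X ω} := by
  set m := deriv (cgf X μ) t
  set A := {ω | |X ω - m| < r}
  have hexp : Integrable (fun ω => Real.exp (t * X ω)) μ :=
    interior_subset (s := integrableExpSet X μ) hX
  have htilted : (μ.tilted (fun ω => t * X ω)).real A ≤
      Real.exp (t * (m + r)) / mgf X μ t * μ.real A :=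
    measureReal_tilted_le_of_forall_le fun ω (hω : |X ω - m| < r) =>
      mul_le_mul_of_nonneg_left (by linarith [(abs_lt.1 hω).2]) ht
  have hsub : A ⊆ {ω | m - r ≤ X ω} := fun ω (hω : |X ω - m| < r) =>
    (by linarith [(abs_lt.1 hω).1] : m - r ≤ X ω)
  calc Real.exp (cgf X μ t - t * (m + r)) * (1 - iteratedDeriv 2 (cgf X μ) t / r ^ 2)
      ≤ Real.exp (cgf X μ t - t * (m + r)) *
          (Real.exp (t * (m + r)) / mgf X μ t * μ.real A) := by
        gcongr
        exact (one_sub_le_measureReal_tilted_abs_sub_deriv_cgf_lt hX hr).trans htilted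
    _ = μ.real A := by
        rw [Real.exp_sub, exp_cgf hexp]
        have := (mgf_pos' (NeZero.ne μ) hexp).ne'
        field_simp
    _ ≤ μ.real {ω | m - r ≤ X ω} := measureReal_mono hsub

end Tilting

section Tail

variable {Ω : Type*} [MeasurableSpace Ω] {μ : Measure Ω} {X : Ω → ℝ} {ε : ℝ}

lemma eventually_measureReal_ge_le_exp_neg_mul_log [IsFiniteMeasure μ]
    (hint : ∀ᶠ t in atTop, t ∈ integrableExpSet X μ)
    (hcgf : cgf X μ =o[atTop] fun t => t * Real.exp t) (hε : 0 < ε) :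
    ∀ᶠ y in atTop, μ.real {ω | y ≤ X ω} ≤ Real.exp (-((1 - ε) * (y * Real.log y))) := by
  filter_upwards [Real.tendsto_log_atTop.eventually hint,
    Real.tendsto_log_atTop.eventually (hcgf.bound hε), eventually_gt_atTop 1]
    with y hyint hybound hy
  have hlog : 0 < Real.log y := Real.log_pos hy
  refine (measure_ge_le_exp_cgf y hlog.le hyint).trans (Real.exp_le_exp.2 ?_)
  have hy0 : 0 < y := by linarith
  rw [Real.exp_log hy0, Real.norm_of_nonneg (mul_pos hlog hy0).le] at hybound
  nlinarith [Real.le_norm_self (cgf X μ (Real.log y))]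

lemma eventually_half_exp_neg_le_measureReal_ge_mul_deriv_cgf [IsFiniteMeasure μ] [NeZero μ]
    (hint : ∀ᶠ t in atTop, t ∈ interior (integrableExpSet X μ))
    (hcgf : ∀ᶠ t in atTop, 0 ≤ cgf X μ t)
    (hmean : Tendsto (deriv (cgf X μ)) atTop atTop)
    (hvar : iteratedDeriv 2 (cgf X μ) =o[atTop] fun t => deriv (cgf X μ) t ^ 2)
    {δ : ℝ} (hδ : 0 < δ) :
    ∀ᶠ t in atTop, Real.exp (-(t * ((1 + δ) * deriv (cgf X μ) t))) * (1 / 2) ≤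
      μ.real {ω | (1 - δ) * deriv (cgf X μ) t ≤ X ω} := by
  filter_upwards [hint, hcgf, eventually_ge_atTop 0, hmean.eventually_gt_atTop 0,
    hvar.bound (show 0 < δ ^ 2 / 2 by positivity)] with t htint htcgf ht htmean htvar
  set m := deriv (cgf X μ) t
  have hvar_le : iteratedDeriv 2 (cgf X μ) t / (δ * m) ^ 2 ≤ 1 / 2 := by
    rw [Real.norm_of_nonneg (sq_nonneg m)] at htvar
    rw [div_le_iff₀ (by positivity)]
    linarith [Real.le_norm_self (iteratedDeriv 2 (cgf X μ) t)]
  calc Real.exp (-(t * ((1 + δ) * m))) * (1 / 2)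
      ≤ Real.exp (cgf X μ t - t * (m + δ * m)) *
          (1 - iteratedDeriv 2 (cgf X μ) t / (δ * m) ^ 2) := by
        gcongr <;> linarith
    _ ≤ μ.real {ω | (1 - δ) * m ≤ X ω} := by
        rw [sub_mul, one_mul]
        exact le_measureReal_deriv_cgf_sub_le ht htint (by positivity)

lemma eventually_exp_neg_ratio_mul_log_le_measureReal_ge [IsFiniteMeasure μ] [NeZero μ]
    (hint : ∀ᶠ t in atTop, t ∈ interior (integrableExpSet X μ))
    (hcgf : ∀ᶠ t in atTop, 0 ≤ cgf X μ t)
    (hmean : ∀ θ < 1, Tendsto (fun t => deriv (cgf X μ) t / Real.exp (θ * t)) atTop atTop)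
    (hvar : iteratedDeriv 2 (cgf X μ) =o[atTop] fun t => deriv (cgf X μ) t ^ 2)
    {δ : ℝ} (hδ : 0 < δ) (hδ1 : δ < 1) :
    ∀ᶠ y in atTop,
      Real.exp (-((1 + δ) / (1 - δ) ^ 2 * (y * Real.log y))) * (1 / 2) ≤ μ.real {ω | y ≤ X ω} := by
  have hδ_sub : 0 < 1 - δ := sub_pos.2 hδ1
  set m := deriv (cgf X μ)
  have hm : Tendsto m atTop atTop := by simpa using hmean 0 one_pos
  have hsurj : atTop ≤ map (fun t => (1 - δ) * m t) atTop :=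
    atTop_le_map_of_tendsto_of_continuousAt (hm.const_mul_atTop hδ_sub) <| by
      filter_upwards [hint] with t ht
      exact (analyticAt_cgf ht).deriv.continuousAt.const_mul _
  suffices h : ∀ᶠ t in atTop,
      Real.exp (-((1 + δ) / (1 - δ) ^ 2 * ((1 - δ) * m t * Real.log ((1 - δ) * m t)))) * (1 / 2) ≤
        μ.real {ω | (1 - δ) * m t ≤ X ω} from hsurj h
  filter_upwards [eventually_half_exp_neg_le_measureReal_ge_mul_deriv_cgf hint hcgf hm hvar hδ,
    hm.eventually_gt_atTop 0, (hmean (1 - δ) (by linarith)).eventually_ge_atTop (1 / (1 - δ))]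
    with t htail htmean htgrowth
  set y := (1 - δ) * m t with hy
  have hlog : (1 - δ) * t ≤ Real.log y := by
    rw [div_le_div_iff₀ hδ_sub (Real.exp_pos _), one_mul, mul_comm (m t)] at htgrowth
    exact (Real.le_log_iff_exp_le (by positivity)).2 htgrowth
  have hexponent : t * ((1 + δ) * m t) ≤ (1 + δ) / (1 - δ) ^ 2 * (y * Real.log y) := by
    calc t * ((1 + δ) * m t) = (1 + δ) / (1 - δ) ^ 2 * (y * ((1 - δ) * t)) := by
          rw [hy]; field_simp
      _ ≤ (1 + δ) / (1 - δ) ^ 2 * (y * Real.log y) := by gcongr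
  exact le_trans (by gcongr) htail

lemma eventually_exp_neg_mul_log_le_measureReal_ge [IsFiniteMeasure μ] [NeZero μ]
    (hint : ∀ᶠ t in atTop, t ∈ interior (integrableExpSet X μ))
    (hcgf : ∀ᶠ t in atTop, 0 ≤ cgf X μ t)
    (hmean : ∀ θ < 1, Tendsto (fun t => deriv (cgf X μ) t / Real.exp (θ * t)) atTop atTop)
    (hvar : iteratedDeriv 2 (cgf X μ) =o[atTop] fun t => deriv (cgf X μ) t ^ 2)
    (hε : 0 < ε) :
    ∀ᶠ y in atTop, Real.exp (-((1 + ε) * (y * Real.log y))) ≤ μ.real {ω | y ≤ X ω} := by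
  obtain ⟨δ, hδε, hδ0, hδ1⟩ : ∃ δ : ℝ, (1 + δ) / (1 - δ) ^ 2 + δ < 1 + ε ∧ 0 < δ ∧ δ < 1 := by
    have hcont : ContinuousAt (fun δ : ℝ => (1 + δ) / (1 - δ) ^ 2 + δ) 0 :=
      ContinuousAt.add (ContinuousAt.div (by fun_prop) (by fun_prop) (by norm_num)) continuousAt_id
    have hlt : ∀ᶠ δ in 𝓝[>] (0 : ℝ), (1 + δ) / (1 - δ) ^ 2 + δ < 1 + ε :=
      (hcont.eventually_lt_const (by simpa using hε)).filter_mono nhdsWithin_le_nhds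
    exact (hlt.and (Ioo_mem_nhdsGT one_pos)).exists
  have hylog : Tendsto (fun y => y * Real.log y) atTop atTop :=
    tendsto_id.atTop_mul_atTop₀ Real.tendsto_log_atTop
  have hhalf : ∀ᶠ y : ℝ in atTop, Real.exp (-(δ * (y * Real.log y))) ≤ 1 / 2 :=
    (Real.tendsto_exp_neg_atTop_nhds_zero.comp
      (hylog.const_mul_atTop hδ0)).eventually_le_const (by norm_num)
  filter_upwards [eventually_exp_neg_ratio_mul_log_le_measureReal_ge hint hcgf hmean hvar hδ0 hδ1,
    hhalf, hylog.eventually_ge_atTop 0] with y htail hyhalf hy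
  calc Real.exp (-((1 + ε) * (y * Real.log y)))
      ≤ Real.exp (-(((1 + δ) / (1 - δ) ^ 2 + δ) * (y * Real.log y))) := by gcongr
    _ = Real.exp (-((1 + δ) / (1 - δ) ^ 2 * (y * Real.log y))) *
          Real.exp (-(δ * (y * Real.log y))) := by
        rw [← Real.exp_add]
        ring_nf
    _ ≤ Real.exp (-((1 + δ) / (1 - δ) ^ 2 * (y * Real.log y))) * (1 / 2) := by gcongr
    _ ≤ μ.real {ω | y ≤ X ω} := htail

lemma isEquivalent_log_measureReal_ge [IsFiniteMeasure μ] [NeZero μ]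
    (hint : ∀ᶠ t in atTop, t ∈ interior (integrableExpSet X μ))
    (hcgf : cgf X μ =o[atTop] fun t => t * Real.exp t) (hcgf_nonneg : ∀ᶠ t in atTop, 0 ≤ cgf X μ t)
    (hmean : ∀ θ < 1, Tendsto (fun t => deriv (cgf X μ) t / Real.exp (θ * t)) atTop atTop)
    (hvar : iteratedDeriv 2 (cgf X μ) =o[atTop] fun t => deriv (cgf X μ) t ^ 2) :
    (fun y => Real.log (μ.real {ω | y ≤ X ω})) ~[atTop] fun y => -(y * Real.log y) :=
  isEquivalent_log_neg_of_eventually_exp_le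
    ((tendsto_id.atTop_mul_atTop₀ Real.tendsto_log_atTop).eventually_ge_atTop 0)
    (fun _ => eventually_exp_neg_mul_log_le_measureReal_ge hint hcgf_nonneg hmean hvar)
    (fun _ => eventually_measureReal_ge_le_exp_neg_mul_log
      (hint.mono fun _ ht => interior_subset ht) hcgf)

end Tail

section Exponent

lemma hasDerivAt_integral_mul_exp {f : ℝ → ℝ} {a b : ℝ} (hf : IntervalIntegrable f volume a b)
    (l : ℝ) :
    HasDerivAt (fun l => ∫ u in a..b, f u * Real.exp (l * u))
      (∫ u in a..b, f u * (u * Real.exp (l * u))) l := by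
  refine (intervalIntegral.hasDerivAt_integral_of_dominated_loc_of_deriv_le
    (F := fun l u => f u * Real.exp (l * u)) (F' := fun l u => f u * (u * Real.exp (l * u)))
    (bound := fun u => |f u| * (|u| * Real.exp ((|l| + 1) * |u|)))
    (Metric.ball_mem_nhds l one_pos) (Eventually.of_forall fun x => ?_)
    (hf.mul_continuousOn (by fun_prop)) ?_ (ae_of_all _ fun u _ x hx => ?_)
    (hf.abs.mul_continuousOn (by fun_prop)) (ae_of_all _ fun u _ x _ => ?_)).2
  · exact hf.aestronglyMeasurable_restrict_uIoc.mul (by fun_prop)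
  · exact hf.aestronglyMeasurable_restrict_uIoc.mul (by fun_prop)
  · have hx' : |x| ≤ |l| + 1 := by
      have : |x - l| < 1 := hx
      linarith [abs_sub_abs_le_abs_sub x l]
    have hxu : x * u ≤ (|l| + 1) * |u| :=
      calc x * u ≤ |x| * |u| := (le_abs_self _).trans_eq (abs_mul x u)
        _ ≤ (|l| + 1) * |u| := by gcongr
    simp only [norm_mul, Real.norm_eq_abs, Real.abs_exp]
    gcongr
  · simpa [mul_comm] using (((hasDerivAt_id x).mul_const u).exp.const_mul (f u))

/-- The Laplace transform of the measure `(1 - u) du` on `[0, 1]`, which is, up to the factor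
`(α + 1) / α`, the derivative of the Laplace exponent `xiExponent α`. -/
noncomputable def triangularLaplace (l : ℝ) : ℝ :=
  ∫ u in (0 : ℝ)..1, (1 - u) * Real.exp (l * u)

lemma hasDerivAt_triangularLaplace (l : ℝ) :
    HasDerivAt triangularLaplace (∫ u in (0 : ℝ)..1, (1 - u) * (u * Real.exp (l * u))) l :=
  hasDerivAt_integral_mul_exp (Continuous.intervalIntegrable (by fun_prop) 0 1) l

lemma continuous_triangularLaplace : Continuous triangularLaplace :=
  continuous_iff_continuousAt.2 fun l => (hasDerivAt_triangularLaplace l).continuousAt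

lemma triangularLaplace_nonneg (l : ℝ) : 0 ≤ triangularLaplace l :=
  intervalIntegral.integral_nonneg zero_le_one fun _ hu =>
    mul_nonneg (sub_nonneg.2 hu.2) (Real.exp_pos _).le

lemma deriv_triangularLaplace_nonneg (l : ℝ) : 0 ≤ deriv triangularLaplace l := by
  rw [(hasDerivAt_triangularLaplace l).deriv]
  exact intervalIntegral.integral_nonneg zero_le_one fun _ hu =>
    mul_nonneg (sub_nonneg.2 hu.2) (mul_nonneg hu.1 (Real.exp_pos _).le)

lemma deriv_triangularLaplace_le (l : ℝ) : deriv triangularLaplace l ≤ triangularLaplace l := by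
  rw [(hasDerivAt_triangularLaplace l).deriv]
  refine intervalIntegral.integral_mono_on zero_le_one
    (Continuous.intervalIntegrable (by fun_prop) _ _)
    (Continuous.intervalIntegrable (by fun_prop) _ _) fun u hu => ?_
  exact mul_le_mul_of_nonneg_left (mul_le_of_le_one_left (Real.exp_pos _).le hu.2)
    (sub_nonneg.2 hu.2)

lemma triangularLaplace_le_exp {l : ℝ} (hl : 0 ≤ l) : triangularLaplace l ≤ Real.exp l := by
  calc triangularLaplace l ≤ ∫ _ in (0 : ℝ)..1, Real.exp l := by
        refine intervalIntegral.integral_mono_on zero_le_one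
          (Continuous.intervalIntegrable (by fun_prop) _ _) intervalIntegrable_const fun u hu => ?_
        calc (1 - u) * Real.exp (l * u) ≤ 1 * Real.exp (l * 1) := by
              gcongr
              exacts [by linarith [hu.1], hu.2]
          _ = Real.exp l := by ring_nf
    _ = Real.exp l := by simp

lemma mul_exp_le_triangularLaplace {l θ : ℝ} (hl : 0 ≤ l) (hθ : 0 ≤ θ) (hθ1 : θ ≤ 1) :
    (1 - θ) ^ 2 / 2 * Real.exp (θ * l) ≤ triangularLaplace l := by
  calc (1 - θ) ^ 2 / 2 * Real.exp (θ * l) = ∫ u in θ..1, (1 - u) * Real.exp (l * θ) := by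
        rw [intervalIntegral.integral_mul_const, intervalIntegral.integral_sub (by simp) (by simp),
          integral_one, integral_id]
        ring_nf
    _ ≤ ∫ u in θ..1, (1 - u) * Real.exp (l * u) := by
        refine intervalIntegral.integral_mono_on hθ1
          (Continuous.intervalIntegrable (by fun_prop) _ _)
          (Continuous.intervalIntegrable (by fun_prop) _ _) fun u hu => ?_
        have := sub_nonneg.2 hu.2
        gcongr
        exact hu.1
    _ ≤ triangularLaplace l := by
        refine intervalIntegral.integral_mono_interval hθ hθ1 le_rfl ?_
          (Continuous.intervalIntegrable (by fun_prop) _ _)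
        filter_upwards [ae_restrict_mem measurableSet_Ioc] with u hu
        exact mul_nonneg (sub_nonneg.2 hu.2) (Real.exp_pos _).le

lemma tendsto_triangularLaplace_div_exp {θ : ℝ} (hθ : θ < 1) :
    Tendsto (fun t => triangularLaplace t / Real.exp (θ * t)) atTop atTop := by
  obtain ⟨η, hη, hη1⟩ := exists_between (max_lt hθ one_pos)
  obtain ⟨hθη, hη0⟩ := max_lt_iff.1 hη
  have hlower : Tendsto (fun t => (1 - η) ^ 2 / 2 * Real.exp ((η - θ) * t)) atTop atTop :=
    (Real.tendsto_exp_atTop.comp (tendsto_id.const_mul_atTop (sub_pos.2 hθη))).const_mul_atTop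
      (by have := sub_pos.2 hη1; positivity)
  refine tendsto_atTop_mono' _ ?_ hlower
  filter_upwards [eventually_ge_atTop 0] with t ht
  rw [sub_mul, Real.exp_sub, ← mul_div_assoc]
  gcongr
  exact mul_exp_le_triangularLaplace ht hη0.le hη1.le

lemma integral_exp_mul_eq_div {u : ℝ} (hu : u ≠ 0) (l : ℝ) :
    ∫ s in (0 : ℝ)..l, Real.exp (s * u) = (Real.exp (l * u) - 1) / u := by
  simp [intervalIntegral.integral_comp_mul_right Real.exp hu, div_eq_inv_mul]

lemma xiExponent_eq_mul_integral_triangularLaplace (α l : ℝ) :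
    xiExponent α l = (α + 1) / α * ∫ s in (0 : ℝ)..l, triangularLaplace s := by
  have hcont : Continuous (Function.uncurry fun u s : ℝ => (1 - u) * Real.exp (s * u)) := by
    fun_prop
  have hswap : ∫ u in (0 : ℝ)..1, ∫ s in (0 : ℝ)..l, (1 - u) * Real.exp (s * u) =
      ∫ s in (0 : ℝ)..l, triangularLaplace s :=
    intervalIntegral_intervalIntegral_swap
      ((hcont.continuousOn.integrableOn_compact (isCompact_uIcc.prod isCompact_uIcc)).mono_set
        (Set.prod_mono Set.uIoc_subset_uIcc Set.uIoc_subset_uIcc))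
  rw [xiExponent, ← hswap]
  congr 1
  refine intervalIntegral.integral_congr_ae (ae_of_all _ fun u hu => ?_)
  rw [Set.uIoc_of_le zero_le_one] at hu
  rw [intervalIntegral.integral_const_mul, integral_exp_mul_eq_div hu.1.ne']
  ring

lemma hasDerivAt_xiExponent (α l : ℝ) :
    HasDerivAt (xiExponent α) ((α + 1) / α * triangularLaplace l) l := by
  rw [funext (xiExponent_eq_mul_integral_triangularLaplace α)]
  exact (continuous_triangularLaplace.integral_hasStrictDerivAt 0 l).hasDerivAt.const_mul _

lemma deriv_xiExponent (α : ℝ) :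
    deriv (xiExponent α) = fun l => (α + 1) / α * triangularLaplace l :=
  funext fun l => (hasDerivAt_xiExponent α l).deriv

lemma iteratedDeriv_two_xiExponent (α : ℝ) :
    iteratedDeriv 2 (xiExponent α) = fun l => (α + 1) / α * deriv triangularLaplace l := by
  ext l
  rw [iteratedDeriv_succ, iteratedDeriv_one, deriv_xiExponent,
    deriv_const_mul _ (hasDerivAt_triangularLaplace l).differentiableAt]

variable {α : ℝ}

lemma xiExponent_nonneg {l : ℝ} (hα : 0 ≤ (α + 1) / α) (hl : 0 ≤ l) : 0 ≤ xiExponent α l := by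
  rw [xiExponent_eq_mul_integral_triangularLaplace]
  exact mul_nonneg hα (intervalIntegral.integral_nonneg hl fun s _ => triangularLaplace_nonneg s)

lemma xiExponent_le_mul_exp {l : ℝ} (hα : 0 ≤ (α + 1) / α) (hl : 0 ≤ l) :
    xiExponent α l ≤ (α + 1) / α * Real.exp l := by
  rw [xiExponent_eq_mul_integral_triangularLaplace]
  refine mul_le_mul_of_nonneg_left ?_ hα
  calc ∫ s in (0 : ℝ)..l, triangularLaplace s ≤ ∫ s in (0 : ℝ)..l, Real.exp s :=
        intervalIntegral.integral_mono_on hl (continuous_triangularLaplace.intervalIntegrable _ _)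
          (Real.continuous_exp.intervalIntegrable _ _) fun s hs => triangularLaplace_le_exp hs.1
    _ ≤ Real.exp l := by simp [integral_exp]

lemma xiExponent_isLittleO (hα : 0 ≤ (α + 1) / α) :
    xiExponent α =o[atTop] fun t => t * Real.exp t := by
  have hbigO : xiExponent α =O[atTop] Real.exp := by
    refine IsBigO.of_bound ((α + 1) / α) ?_
    filter_upwards [eventually_ge_atTop 0] with t ht
    rw [Real.norm_of_nonneg (xiExponent_nonneg hα ht), Real.norm_of_nonneg (Real.exp_pos t).le]
    exact xiExponent_le_mul_exp hα ht
  have hone : (fun _ => 1 : ℝ → ℝ) =o[atTop] id :=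
    isLittleO_const_id_atTop 1
  simpa using hone.mul_isBigO hbigO

lemma tendsto_deriv_xiExponent_div_exp (hα : 0 < (α + 1) / α) {θ : ℝ} (hθ : θ < 1) :
    Tendsto (fun t => deriv (xiExponent α) t / Real.exp (θ * t)) atTop atTop := by
  simp_rw [deriv_xiExponent, mul_div_assoc]
  exact (tendsto_triangularLaplace_div_exp hθ).const_mul_atTop hα

lemma iteratedDeriv_two_xiExponent_isLittleO (hα : 0 < (α + 1) / α) :
    iteratedDeriv 2 (xiExponent α) =o[atTop] fun t => deriv (xiExponent α) t ^ 2 := by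
  have hbigO : iteratedDeriv 2 (xiExponent α) =O[atTop] deriv (xiExponent α) := by
    refine IsBigO.of_bound 1 (Eventually.of_forall fun t => ?_)
    simp only [iteratedDeriv_two_xiExponent, deriv_xiExponent, one_mul, norm_mul,
      Real.norm_of_nonneg (deriv_triangularLaplace_nonneg t),
      Real.norm_of_nonneg (triangularLaplace_nonneg t)]
    gcongr
    exact deriv_triangularLaplace_le t
  have hderiv : Tendsto (deriv (xiExponent α)) atTop atTop := by
    simpa using tendsto_deriv_xiExponent_div_exp hα one_pos
  have hsq : (fun x : ℝ => x) =o[atTop] fun x => x ^ 2 := by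
    simpa using isLittleO_pow_pow_atTop_of_lt (𝕜 := ℝ) one_lt_two
  exact hbigO.trans_isLittleO (hsq.comp_tendsto hderiv)

end Exponent

namespace IsXiLaw

variable {α : ℝ} {ν : Measure ℝ}

lemma cgf_eq (hν : IsXiLaw α ν) : cgf id ν = xiExponent α := by
  ext l
  rw [cgf, hν.mgf_eq, Real.log_exp]

lemma integrableExpSet_eq_univ (hν : IsXiLaw α ν) : integrableExpSet id ν = Set.univ :=
  Set.eq_univ_of_forall hν.integrable_exp

lemma isEquivalent_log_measureReal_Ici (hν : IsXiLaw α ν) (hα : 0 < (α + 1) / α) :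
    (fun y => Real.log (ν.real (Set.Ici y))) ~[atTop] fun y => -(y * Real.log y) := by
  have := hν.isProbabilityMeasure
  refine isEquivalent_log_measureReal_ge (X := id) (Eventually.of_forall fun t => ?_)
    ?_ ?_ ?_ ?_
  · simp [hν.integrableExpSet_eq_univ]
  all_goals rw [hν.cgf_eq]
  · exact xiExponent_isLittleO hα.le
  · exact (eventually_ge_atTop 0).mono fun t => xiExponent_nonneg hα.le
  · exact fun θ => tendsto_deriv_xiExponent_div_exp hα
  · exact iteratedDeriv_two_xiExponent_isLittleO hα

end IsXiLaw

section Maximum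

variable {ι Ω : Type*} [Fintype ι] [MeasurableSpace Ω] {μ : Measure Ω} {ν : Measure ℝ}
  {X : ι → Ω → ℝ}

lemma measureReal_le_iSup_le [Nonempty ι] [IsFiniteMeasure μ] (hlaw : ∀ i, HasLaw (X i) ν μ)
    (y : ℝ) :
    μ.real {ω | y ≤ ⨆ i, X i ω} ≤ Fintype.card ι * ν.real (Set.Ici y) := by
  calc μ.real {ω | y ≤ ⨆ i, X i ω} ≤ μ.real (⋃ i, {ω | y ≤ X i ω}) := by
        refine measureReal_mono fun ω hω => ?_
        obtain ⟨i, hi⟩ := exists_eq_ciSup_of_finite (f := fun i => X i ω)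
        exact Set.mem_iUnion.2 ⟨i, hω.trans_eq hi.symm⟩
    _ ≤ ∑ i, μ.real {ω | y ≤ X i ω} := measureReal_iUnion_fintype_le _
    _ = ∑ _ : ι, ν.real (Set.Ici y) :=
        Finset.sum_congr rfl fun i _ => (hlaw i).measureReal_eq measurableSet_Ici
    _ = Fintype.card ι * ν.real (Set.Ici y) := by simp

lemma measureReal_iSup_lt_le [IsProbabilityMeasure μ] (hlaw : ∀ i, HasLaw (X i) ν μ)
    (hindep : iIndepFun X μ) (y : ℝ) :
    μ.real {ω | ⨆ i, X i ω < y} ≤ Real.exp (-(Fintype.card ι * ν.real (Set.Ici y))) := by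
  have hone (i : ι) : μ.real (X i ⁻¹' Set.Iio y) ≤ Real.exp (-ν.real (Set.Ici y)) := by
    have : IsProbabilityMeasure ν := (hlaw i).isProbabilityMeasure_iff.1 inferInstance
    calc μ.real (X i ⁻¹' Set.Iio y) = ν.real (Set.Iio y) :=
          (hlaw i).measureReal_eq measurableSet_Iio
      _ = 1 - ν.real (Set.Ici y) := by
          rw [← Set.compl_Ici, probReal_compl_eq_one_sub measurableSet_Ici]
      _ ≤ Real.exp (-ν.real (Set.Ici y)) := Real.one_sub_le_exp_neg _
  calc μ.real {ω | ⨆ i, X i ω < y} ≤ μ.real (⋂ i ∈ Finset.univ, X i ⁻¹' Set.Iio y) := by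
        refine measureReal_mono fun ω hω => Set.mem_iInter₂.2 fun i _ => ?_
        exact (le_ciSup (Set.finite_range fun i => X i ω).bddAbove i).trans_lt hω
    _ = ∏ i, μ.real (X i ⁻¹' Set.Iio y) := by
        rw [measureReal_def, hindep.measure_inter_preimage_eq_mul Finset.univ
          (sets := fun _ => Set.Iio y) fun _ _ => measurableSet_Iio, ENNReal.toReal_prod]
        rfl
    _ ≤ ∏ _ : ι, Real.exp (-ν.real (Set.Ici y)) :=
        Finset.prod_le_prod (fun _ _ => measureReal_nonneg) fun i _ => hone i
    _ = Real.exp (-(Fintype.card ι * ν.real (Set.Ici y))) := by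
        rw [← Real.exp_sum]
        simp

end Maximum

section Array

lemma tendstoInMeasure_iSup_div {Ω : Type*} [MeasurableSpace Ω] {μ : Measure Ω}
    [IsProbabilityMeasure μ] {ν : ℕ → Measure ℝ} {ξ : (n : ℕ) → Fin n → Ω → ℝ} {a : ℕ → ℝ}
    (ha : ∀ᶠ n in atTop, 0 < a n) (hlaw : ∀ n i, HasLaw (ξ n i) (ν n) μ)
    (hindep : ∀ n, iIndepFun (ξ n) μ)
    (hupper : ∀ c > 1, Tendsto (fun n => n * (ν n).real (Set.Ici (c * a n))) atTop (𝓝 0))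
    (hlower : ∀ c, 0 < c → c < 1 →
      Tendsto (fun n => n * (ν n).real (Set.Ici (c * a n))) atTop atTop) :
    TendstoInMeasure μ (fun n ω => (⨆ i, ξ n i ω) / a n) atTop (fun _ => (1 : ℝ)) := by
  rw [tendstoInMeasure_iff_measureReal_dist]
  intro ε hε
  obtain ⟨c, hcε, hc1⟩ := exists_between (max_lt (sub_lt_self 1 hε) one_pos)
  obtain ⟨hcε, hc0⟩ := max_lt_iff.1 hcε
  have hhigh := hupper (1 + ε) (by linarith)
  have hlow := Real.tendsto_exp_neg_atTop_nhds_zero.comp (hlower c hc0 hc1)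
  refine squeeze_zero' (Eventually.of_forall fun n => measureReal_nonneg) ?_
    (by simpa using hhigh.add hlow)
  filter_upwards [ha, eventually_gt_atTop 0] with n han hn
  have : Nonempty (Fin n) := ⟨⟨0, hn⟩⟩
  calc μ.real {ω | ε ≤ dist ((⨆ i, ξ n i ω) / a n) 1}
      ≤ μ.real ({ω | (1 + ε) * a n ≤ ⨆ i, ξ n i ω} ∪ {ω | ⨆ i, ξ n i ω < c * a n}) := by
        refine measureReal_mono fun ω hω => ?_
        rcases le_abs.1 (show ε ≤ |(⨆ i, ξ n i ω) / a n - 1| from hω) with h | h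
        · exact Or.inl ((le_div_iff₀ han).1 (by linarith))
        · exact Or.inr ((div_lt_iff₀ han).1 (by linarith))
    _ ≤ μ.real {ω | (1 + ε) * a n ≤ ⨆ i, ξ n i ω} + μ.real {ω | ⨆ i, ξ n i ω < c * a n} :=
        measureReal_union_le _ _
    _ ≤ n * (ν n).real (Set.Ici ((1 + ε) * a n)) +
          Real.exp (-(n * (ν n).real (Set.Ici (c * a n)))) := by
        simpa using add_le_add (measureReal_le_iSup_le (hlaw n) ((1 + ε) * a n))
          (measureReal_iSup_lt_le (hlaw n) (hindep n) (c * a n))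

end Array

section LogScale

lemma tendsto_id_div_log_atTop : Tendsto (fun x : ℝ => x / Real.log x) atTop atTop := by
  have h : Tendsto (fun s : ℝ => Real.exp s / s) atTop atTop := by
    simpa using Real.tendsto_exp_div_pow_atTop 1
  refine (h.comp Real.tendsto_log_atTop).congr' ?_
  filter_upwards [eventually_gt_atTop 0] with x hx
  simp [Real.exp_log hx]

/-- So `x / log x` inverts `y ↦ y * log y` asymptotically. -/
lemma isEquivalent_mul_log_div_log {c : ℝ} (hc : 0 < c) :
    (fun x => c * (x / Real.log x) * Real.log (c * (x / Real.log x))) ~[atTop] fun x => c * x := by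
  have hlog : (fun x => Real.log (c * (x / Real.log x))) ~[atTop] Real.log := by
    have hlittle : (fun x => Real.log c - Real.log (Real.log x)) =o[atTop] Real.log :=
      Real.isLittleO_const_log_atTop.sub
        (Real.isLittleO_log_id_atTop.comp_tendsto Real.tendsto_log_atTop)
    refine (IsEquivalent.refl.add_isLittleO hlittle).congr_left ?_
    filter_upwards [eventually_gt_atTop 1] with x hx
    have := Real.log_pos hx
    rw [Pi.add_apply, Real.log_mul hc.ne' (by positivity), Real.log_div (by positivity) this.ne']
    ring
  refine (IsEquivalent.refl.mul hlog).congr_right ?_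
  filter_upwards [eventually_gt_atTop 1] with x hx
  have := (Real.log_pos hx).ne'
  simp only [Pi.mul_apply]
  field_simp

variable {κ : Type*} {l : Filter κ} {x p : κ → ℝ} {c : ℝ}

lemma eventuallyEq_exp_log_mul_one_add (hx : Tendsto x l atTop) (hp : ∀ n, 0 ≤ p n)
    (hpx : Tendsto (fun n => Real.log (p n) / Real.log (x n)) l (𝓝 (-c))) (hc : 0 < c) :
    (fun n => Real.exp (Real.log (x n) * (1 + Real.log (p n) / Real.log (x n)))) =ᶠ[l]
      fun n => x n * p n := by
  filter_upwards [hx.eventually_gt_atTop 1, hpx.eventually_ne (neg_ne_zero.2 hc.ne')] with n hxn hpn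
  have hlog := (Real.log_pos hxn).ne'
  have hpn0 : 0 < p n := (hp n).lt_of_ne fun h => hpn (by simp [← h])
  rw [mul_one_add, mul_div_cancel₀ _ hlog, Real.exp_add, Real.exp_log (by linarith),
    Real.exp_log hpn0]

lemma tendsto_mul_nhds_zero_of_log_div_log (hx : Tendsto x l atTop) (hp : ∀ n, 0 ≤ p n)
    (hpx : Tendsto (fun n => Real.log (p n) / Real.log (x n)) l (𝓝 (-c))) (hc : 1 < c) :
    Tendsto (fun n => x n * p n) l (𝓝 0) :=
  (Real.tendsto_exp_atBot.comp ((Real.tendsto_log_atTop.comp hx).atTop_mul_neg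
    (by linarith) (hpx.const_add 1))).congr'
    (eventuallyEq_exp_log_mul_one_add hx hp hpx (one_pos.trans hc))

lemma tendsto_mul_atTop_of_log_div_log (hx : Tendsto x l atTop) (hp : ∀ n, 0 ≤ p n)
    (hpx : Tendsto (fun n => Real.log (p n) / Real.log (x n)) l (𝓝 (-c))) (hc : 0 < c)
    (hc1 : c < 1) :
    Tendsto (fun n => x n * p n) l atTop :=
  (Real.tendsto_exp_atTop.comp ((Real.tendsto_log_atTop.comp hx).atTop_mul_pos
    (by linarith) (hpx.const_add 1))).congr'
    (eventuallyEq_exp_log_mul_one_add hx hp hpx hc)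

lemma tendsto_log_comp_div_log_div_log {F : ℝ → ℝ}
    (hF : (fun y => Real.log (F y)) ~[atTop] fun y => -(y * Real.log y)) (hc : 0 < c) :
    Tendsto (fun x => Real.log (F (c * (x / Real.log x))) / x) atTop (𝓝 (-c)) := by
  have hscale : Tendsto (fun x => c * (x / Real.log x)) atTop atTop :=
    tendsto_id_div_log_atTop.const_mul_atTop hc
  have hequiv : (fun x => Real.log (F (c * (x / Real.log x)))) ~[atTop] fun x => -(c * x) :=
    (hF.comp_tendsto hscale).trans (isEquivalent_mul_log_div_log hc).neg
  have hquot := hequiv.div (IsEquivalent.refl (u := fun x : ℝ => x))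
  refine (hquot.congr_right ?_).tendsto_const
  filter_upwards [eventually_ne_atTop 0] with x hx
  rw [Pi.div_apply, Function.const_apply]
  field_simp

end LogScale

theorem mainTheorem6_general {ν : Measure ℝ}
    (hν : (fun y => Real.log (ν.real (Set.Ici y))) ~[atTop] fun y => -(y * Real.log y))
    {Ω : Type*} [MeasurableSpace Ω] (μ : Measure Ω) [IsProbabilityMeasure μ]
    (ξ : (n : ℕ) → Fin n → Ω → ℝ)
    (hlaw : ∀ (n : ℕ) (i : Fin n), HasLaw (ξ n i) ν μ)
    (hindep : ∀ n : ℕ, iIndepFun (ξ n) μ) :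
    TendstoInMeasure μ
      (fun (n : ℕ) (ω : Ω) =>
        (⨆ i : Fin n, ξ n i ω) * Real.log (Real.log n) / Real.log n)
      atTop (fun _ => (1 : ℝ)) := by
  have hn : Tendsto (fun n : ℕ => (n : ℝ)) atTop atTop := tendsto_natCast_atTop_atTop
  have hlog := Real.tendsto_log_atTop.comp hn
  have htail (c : ℝ) (hc : 0 < c) := (tendsto_log_comp_div_log_div_log hν hc).comp hlog
  simp_rw [← div_div_eq_mul_div]
  exact tendstoInMeasure_iSup_div (ν := fun _ => ν)
    ((tendsto_id_div_log_atTop.comp hlog).eventually_gt_atTop 0) hlaw hindep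
    (fun c hc => tendsto_mul_nhds_zero_of_log_div_log hn (fun _ => measureReal_nonneg)
      (htail c (one_pos.trans hc)) hc)
    (fun c hc hc1 => tendsto_mul_atTop_of_log_div_log hn (fun _ => measureReal_nonneg)
      (htail c hc) hc hc1)

theorem mainTheorem6 (α : ℝ) (hα : 0 < α) (ν : Measure ℝ) (hν : IsXiLaw α ν)
    {Ω : Type*} [MeasurableSpace Ω] (μ : Measure Ω) [IsProbabilityMeasure μ]
    (ξ : (n : ℕ) → Fin n → Ω → ℝ)
    (hlaw : ∀ (n : ℕ) (i : Fin n), HasLaw (ξ n i) ν μ)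
    (hindep : ∀ n : ℕ, iIndepFun (ξ n) μ) :
    TendstoInMeasure μ
      (fun (n : ℕ) (ω : Ω) =>
        (⨆ i : Fin n, ξ n i ω) * Real.log (Real.log n) / Real.log n)
      atTop (fun _ => (1 : ℝ)) :=
  mainTheorem6_general (hν.isEquivalent_log_measureReal_Ici (by positivity)) μ ξ hlaw hindep
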